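/- **Setting.** Let $\mathbb A_\infty=\{\mathtt a_i\mid i\in\mathbb N\}$ be an infinite set of type atoms, let $\omega\notin\mathbb A_\infty$ be a further atom, and $\mathbb A_\infty^\omega=\mathbb A_\infty\cup\{\omega\}$. Over a set of atoms $\mathbb A\subseteq\mathbb A_\infty^\omega$, *intersection types* are $\sigma::=\mathtt a\mid\sigma\to\sigma\mid\sigma\cap\sigma$ ($\mathtt a\in\mathbb A$). An *intersection type theory* $\mathcal T$ over $\mathbb A$ is a set of sentences $\sigma\le\tau$ closed under: $\sigma\le\sigma$; $\sigma\cap\tau\le\sigma$; $\sigma\cap\tau\le\tau$; $\rho\le\sigma,\ \rho\le\tau\Rightarrow\rho\le\sigma\cap\tau$; $\sigma\le\tau,\ \tau\le\rho\Rightarrow\sigma\le\rho$. Consider the schemes - $(\omega_{top})$ $\ \sigma\le\omega$; - $(\omega_\to)$ $\ \omega\le\sigma\to\omega$; - $({\to}\cap)$ $\ (\sigma\to\tau)\cap(\sigma\to\rho)\le\sigma\to(\tau\cap\rho)$; - $(\to)$ $\ \sigma_2\le\sigma_1,\ \tau_1\le\tau_2\Rightarrow\sigma_1\to\tau_1\le\sigma_2\to\tau_2$.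 CD (over $\mathbb A_\infty$), CDS (over $\mathbb A_\infty^\omega$), CDV (over $\mathbb A_\infty$) and BCD (over $\mathbb A_\infty^\omega$) are the smallest type theories satisfying, respectively, no further scheme; $(\omega_{top})$; $(\to),({\to}\cap)$; all four schemes. *$\Delta$-terms* over $\mathbb A$ are $$\Delta::=u_\Delta\mid x\mid\lambda x{:}\sigma.\Delta\mid\Delta\,\Delta\mid\langle\Delta,\Delta\rangle\mid pr_1\,\Delta\mid pr_2\,\Delta\mid\Delta^\sigma .$$ The *essence* $\wr\Delta\wr$ is the pure $\lambda$-term defined by $\wr x\wr=x$, $\wr\lambda x{:}\sigma.\Delta\wr=\lambda x.\wr\Delta\wr$, $\wr\Delta_1\Delta_2\wr=\wr\Delta_1\wr\,\wr\Delta_2\wr$, $\wr\langle\Delta_1,\Delta_2\rangle\wr=\wr\Delta_1\wr$, and $\wr u_\Delta\wr=\wr pr_i\,\Delta\wr=\wr\Delta^\sigma\wr=\wr\Delta\wr$. For a type theory $\mathcal T$ over $\mathbb A$ and $\mathcal R\in\{\equiv,=_\beta,=_{\beta\eta}\}$ (relations on pure $\lambda$-terms), the judgment $B\vdash^{\mathcal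 T}_{\mathcal R}\Delta:\sigma$, with $B$ a finite basis, is inductively generated by: - $B\vdash u_\Delta:\omega$ (for any $\Delta$) if $\omega\in\mathbb A$; - $B\vdash x:\sigma$ if $x{:}\sigma\in B$; - $B\vdash\lambda x{:}\sigma.\Delta:\sigma\to\tau$ if $B,x{:}\sigma\vdash\Delta:\tau$; - $B\vdash\Delta_1\Delta_2:\tau$ if $B\vdash\Delta_1:\sigma\to\tau$ and $B\vdash\Delta_2:\sigma$; - $B\vdash\langle\Delta_1,\Delta_2\rangle:\sigma\cap\tau$ if $B\vdash\Delta_1:\sigma$, $B\vdash\Delta_2:\tau$ and $\wr\Delta_1\wr\mathrel{\mathcal R}\wr\Delta_2\wr$; - $B\vdash pr_1\,\Delta:\sigma$ and $B\vdash pr_2\,\Delta:\tau$ if $B\vdash\Delta:\sigma\cap\tau$; - $B\vdash\Delta^\tau:\tau$ if $B\vdash\Delta:\sigma$ and $(\sigma\le\tau)\in\mathcal T$. A $\Delta$-term is *typable* in the system $\Delta^{\mathcal T}_{\mathcal R}$ if $B\vdash^{\mathcal T}_{\mathcal R}\Delta:\sigma$ for some $B$ and $\sigma$. The *$\Delta$-chair*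 consists of the ten systems $\Delta^{\mathcal T}_{\equiv}$ and $\Delta^{\mathcal T}_{=_\beta}$ for $\mathcal T\in\{\mathrm{CD},\mathrm{CDV},\mathrm{CDS},\mathrm{BCD}\}$, and $\Delta^{\mathrm{CDV}}_{=_{\beta\eta}}$, $\Delta^{\mathrm{BCD}}_{=_{\beta\eta}}$. **Theorem (Characterization).** In each of the ten systems $\Delta^{\mathcal T}_{\mathcal R}$ of the $\Delta$-chair, and more generally for every intersection type theory $\mathcal T$ over a nonempty set of atoms $\mathbb A\subseteq\mathbb A_\infty^\omega$ and every $\mathcal R\in\{\equiv,=_\beta,=_{\beta\eta}\}$: for every pure $\lambda$-term $M$ that is strongly normalizing (there is no infinite $\beta$-reduction sequence from $M$) there is a $\Delta$-term $\Delta$ over $\mathbb A$, typable in $\Delta^{\mathcal T}_{\mathcal R}$, such that $\wr\Delta\wr\equiv M$. -/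

import Mathlib

namespace DeltaCalculus

/-! ### Pure lambda-terms, with de Bruijn indices (so that syntactic identity is equality) -/

/-- Pure `λ`-terms up to `α`-conversion. -/
inductive Term : Type where
  | var : ℕ → Term
  | lam : Term → Term
  | app : Term → Term → Term

namespace Term

/-- Action of a renaming `f` under one binder. -/
def liftRen (f : ℕ → ℕ) : ℕ → ℕ
  | 0 => 0
  | n + 1 => f n + 1

/-- Renaming of free variables. -/
def rename : (ℕ → ℕ) → Term → Term
  | f, var n => var (f n)
  | f, lam M => lam (rename (liftRen f) M)
  | f, app M N => app (rename f M) (rename f N)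

/-- Weakening by one fresh variable. -/
def shift (M : Term) : Term := rename Nat.succ M

/-- Action of a simultaneous substitution under one binder. -/
def liftSub (s : ℕ → Term) : ℕ → Term
  | 0 => var 0
  | n + 1 => shift (s n)

/-- Simultaneous capture-avoiding substitution. -/
def subst : (ℕ → Term) → Term → Term
  | s, var n => s n
  | s, lam M => lam (subst (liftSub s) M)
  | s, app M N => app (subst s M) (subst s N)

/-- The substitution that replaces variable `0` by `N` and lowers the others. -/
def single (N : Term) : ℕ → Term
  | 0 => N
  | n + 1 => var n

/-- `M[N/x]`, where `x` is variable `0` of `M`. -/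
def inst (M N : Term) : Term := subst (single N) M

/-- One-step `β`-reduction, in any context. -/
inductive Beta : Term → Term → Prop where
  | redex (M N : Term) : Beta (app (lam M) N) (inst M N)
  | lam {M M' : Term} : Beta M M' → Beta (lam M) (lam M')
  | appL {M M' : Term} (N : Term) : Beta M M' → Beta (app M N) (app M' N)
  | appR (M : Term) {N N' : Term} : Beta N N' → Beta (app M N) (app M N')

/-- One-step `η`-reduction, in any context. -/
inductive Eta : Term → Term → Prop where
  | redex (M : Term) : Eta (lam (app (shift M) (var 0))) M
  | lam {M M' : Term} : Eta M M' → Eta (lam M) (lam M')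
  | appL {M M' : Term} (N : Term) : Eta M M' → Eta (app M N) (app M' N)
  | appR (M : Term) {N N' : Term} : Eta N N' → Eta (app M N) (app M N')

/-- `M` is strongly normalizing: there is no infinite `β`-reduction sequence from `M`. -/
def StronglyNormalizing (M : Term) : Prop :=
  ¬ ∃ s : ℕ → Term, s 0 = M ∧ ∀ n, Beta (s n) (s (n + 1))

/-- `=_β`. -/
def BetaEq : Term → Term → Prop := Relation.EqvGen Beta

/-- `=_{βη}`. -/
def BetaEtaEq : Term → Term → Prop := Relation.EqvGen fun M N => Beta M N ∨ Eta M N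

end Term

/-- The three equivalence relations on pure `λ`-terms used in the typed systems. -/
inductive EssRel : Type where
  | syn
  | beta
  | betaEta

/-- The relation denoted by `≡`, `=_β`, `=_{βη}` respectively. -/
def EssRel.Holds : EssRel → Term → Term → Prop
  | syn => Eq
  | beta => Term.BetaEq
  | betaEta => Term.BetaEtaEq

/-! ### Intersection types and type theories -/

/-- Type atoms: `a 0, a 1, …` and the universal type `ω`. -/
inductive Atom : Type where
  | a : ℕ → Atom
  | omega : Atom

/-- `𝔸_∞ = {a_i | i ∈ ℕ}`. -/
def atomsInf : Set Atom := Set.range Atom.a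

/-- `𝔸_∞^ω = 𝔸_∞ ∪ {ω}`. -/
def atomsInfOmega : Set Atom := atomsInf ∪ {Atom.omega}

/-- Intersection types over a set `𝔸` of atoms. -/
inductive Ty (𝔸 : Set Atom) : Type where
  | atom : 𝔸 → Ty 𝔸
  | arrow : Ty 𝔸 → Ty 𝔸 → Ty 𝔸
  | inter : Ty 𝔸 → Ty 𝔸 → Ty 𝔸

/-- The type `ω`, available when `ω ∈ 𝔸`. -/
def Ty.omega {𝔸 : Set Atom} (h : Atom.omega ∈ 𝔸) : Ty 𝔸 := Ty.atom ⟨Atom.omega, h⟩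

/-- An intersection type theory over `𝔸`: a set of sentences `σ ≤ τ` that satisfies at least the
axioms and rules of the minimal type theory. -/
structure TypeTheory (𝔸 : Set Atom) where
  le : Ty 𝔸 → Ty 𝔸 → Prop
  refl : ∀ σ, le σ σ
  incl_left : ∀ σ τ, le (Ty.inter σ τ) σ
  incl_right : ∀ σ τ, le (Ty.inter σ τ) τ
  glb : ∀ {ρ σ τ}, le ρ σ → le ρ τ → le ρ (Ty.inter σ τ)
  trans : ∀ {σ τ ρ}, le σ τ → le τ ρ → le σ ρ

/-- Names of the additional axiom schemes and of the additional rule scheme. -/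
inductive Scheme : Type where
  | omegaTop
  | omegaArrow
  | arrowInter
  | arrow

/-- The smallest relation satisfying the minimal type theory and the schemes in `E`. -/
inductive Le {𝔸 : Set Atom} (E : Set Scheme) : Ty 𝔸 → Ty 𝔸 → Prop where
  | refl (σ : Ty 𝔸) : Le E σ σ
  | incl_left (σ τ : Ty 𝔸) : Le E (Ty.inter σ τ) σ
  | incl_right (σ τ : Ty 𝔸) : Le E (Ty.inter σ τ) τ
  | glb {ρ σ τ : Ty 𝔸} : Le E ρ σ → Le E ρ τ → Le E ρ (Ty.inter σ τ)
  | trans {σ τ ρ : Ty 𝔸} : Le E σ τ → Le E τ ρ → Le E σ ρ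
  | omegaTop (hE : Scheme.omegaTop ∈ E) (h : Atom.omega ∈ 𝔸) (σ : Ty 𝔸) : Le E σ (Ty.omega h)
  | omegaArrow (hE : Scheme.omegaArrow ∈ E) (h : Atom.omega ∈ 𝔸) (σ : Ty 𝔸) :
      Le E (Ty.omega h) (Ty.arrow σ (Ty.omega h))
  | arrowInter (hE : Scheme.arrowInter ∈ E) (σ τ ρ : Ty 𝔸) :
      Le E (Ty.inter (Ty.arrow σ τ) (Ty.arrow σ ρ)) (Ty.arrow σ (Ty.inter τ ρ))
  | arrow (hE : Scheme.arrow ∈ E) {σ₁ σ₂ τ₁ τ₂ : Ty 𝔸} :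
      Le E σ₂ σ₁ → Le E τ₁ τ₂ → Le E (Ty.arrow σ₁ τ₁) (Ty.arrow σ₂ τ₂)

/-- The smallest type theory over `𝔸` satisfying the schemes in `E`. -/
def TypeTheory.generated (𝔸 : Set Atom) (E : Set Scheme) : TypeTheory 𝔸 where
  le := Le E
  refl := Le.refl
  incl_left := Le.incl_left
  incl_right := Le.incl_right
  glb := Le.glb
  trans := Le.trans

/-- Coppo–Dezani. -/
def TypeTheory.CD : TypeTheory atomsInf := generated atomsInf ∅

/-- Coppo–Dezani–Sallé. -/
def TypeTheory.CDS : TypeTheory atomsInfOmega := generated atomsInfOmega {Scheme.omegaTop}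

/-- Coppo–Dezani–Venneri. -/
def TypeTheory.CDV : TypeTheory atomsInf :=
  generated atomsInf {Scheme.arrow, Scheme.arrowInter}

/-- Barendregt–Coppo–Dezani. -/
def TypeTheory.BCD : TypeTheory atomsInfOmega :=
  generated atomsInfOmega
    {Scheme.arrow, Scheme.arrowInter, Scheme.omegaTop, Scheme.omegaArrow}

/-! ### The Delta-calculus -/

/-- `Δ`-terms (de Bruijn indices): the constants `u_Δ`, variables, typed abstractions,
applications, strong pairs, the two projections, and explicit coercions `Δ^σ`. -/
inductive DTerm (𝔸 : Set Atom) : Type where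
  | u : DTerm 𝔸 → DTerm 𝔸
  | var : ℕ → DTerm 𝔸
  | lam : Ty 𝔸 → DTerm 𝔸 → DTerm 𝔸
  | app : DTerm 𝔸 → DTerm 𝔸 → DTerm 𝔸
  | pair : DTerm 𝔸 → DTerm 𝔸 → DTerm 𝔸
  | pr1 : DTerm 𝔸 → DTerm 𝔸
  | pr2 : DTerm 𝔸 → DTerm 𝔸
  | coe : DTerm 𝔸 → Ty 𝔸 → DTerm 𝔸

/-- The essence of a `Δ`-term. -/
def DTerm.essence {𝔸 : Set Atom} : DTerm 𝔸 → Term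
  | u D => essence D
  | var n => Term.var n
  | lam _ D => Term.lam (essence D)
  | app D₁ D₂ => Term.app (essence D₁) (essence D₂)
  | pair D₁ _ => essence D₁
  | pr1 D => essence D
  | pr2 D => essence D
  | coe D _ => essence D

/-- A (finite) basis: the `n`-th entry is the type declared for the variable with index `n`. -/
abbrev Basis (𝔸 : Set Atom) : Type := List (Ty 𝔸)

/-- The typing judgment `B ⊢^T_R Δ : σ` of the generic intersection typed system. -/
inductive Typed {𝔸 : Set Atom} (T : TypeTheory 𝔸) (R : EssRel) :
    Basis 𝔸 → DTerm 𝔸 → Ty 𝔸 → Prop where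
  | top (h : Atom.omega ∈ 𝔸) (B : Basis 𝔸) (D : DTerm 𝔸) : Typed T R B (DTerm.u D) (Ty.omega h)
  | ax {B : Basis 𝔸} {n : ℕ} {σ : Ty 𝔸} : B[n]? = some σ → Typed T R B (DTerm.var n) σ
  | arrowI {B : Basis 𝔸} {σ τ : Ty 𝔸} {D : DTerm 𝔸} :
      Typed T R (σ :: B) D τ → Typed T R B (DTerm.lam σ D) (Ty.arrow σ τ)
  | arrowE {B : Basis 𝔸} {σ τ : Ty 𝔸} {D₁ D₂ : DTerm 𝔸} :
      Typed T R B D₁ (Ty.arrow σ τ) → Typed T R B D₂ σ → Typed T R B (DTerm.app D₁ D₂) τ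
  | interI {B : Basis 𝔸} {σ τ : Ty 𝔸} {D₁ D₂ : DTerm 𝔸} :
      Typed T R B D₁ σ → Typed T R B D₂ τ → R.Holds D₁.essence D₂.essence →
        Typed T R B (DTerm.pair D₁ D₂) (Ty.inter σ τ)
  | interE1 {B : Basis 𝔸} {σ τ : Ty 𝔸} {D : DTerm 𝔸} :
      Typed T R B D (Ty.inter σ τ) → Typed T R B (DTerm.pr1 D) σ
  | interE2 {B : Basis 𝔸} {σ τ : Ty 𝔸} {D : DTerm 𝔸} :
      Typed T R B D (Ty.inter σ τ) → Typed T R B (DTerm.pr2 D) τ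
  | sub {B : Basis 𝔸} {σ τ : Ty 𝔸} {D : DTerm 𝔸} :
      Typed T R B D σ → T.le σ τ → Typed T R B (DTerm.coe D τ) τ

/-- A `Δ`-term is typable in the system given by `T` and `R` if it has a type in some basis. -/
def Typable {𝔸 : Set Atom} (T : TypeTheory 𝔸) (R : EssRel) (D : DTerm 𝔸) : Prop :=
  ∃ (B : Basis 𝔸) (σ : Ty 𝔸), Typed T R B D σ

/-- The ten typed systems of the `Δ`-chair. -/
inductive Chair : (𝔸 : Set Atom) → TypeTheory 𝔸 → EssRel → Prop where
  | CD_syn : Chair atomsInf TypeTheory.CD EssRel.syn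
  | CDV_syn : Chair atomsInf TypeTheory.CDV EssRel.syn
  | CDS_syn : Chair atomsInfOmega TypeTheory.CDS EssRel.syn
  | BCD_syn : Chair atomsInfOmega TypeTheory.BCD EssRel.syn
  | CD_beta : Chair atomsInf TypeTheory.CD EssRel.beta
  | CDV_beta : Chair atomsInf TypeTheory.CDV EssRel.beta
  | CDS_beta : Chair atomsInfOmega TypeTheory.CDS EssRel.beta
  | BCD_beta : Chair atomsInfOmega TypeTheory.BCD EssRel.beta
  | CDV_betaEta : Chair atomsInf TypeTheory.CDV EssRel.betaEta
  | BCD_betaEta : Chair atomsInfOmega TypeTheory.BCD EssRel.betaEta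

end DeltaCalculus

namespace DeltaCalculus

/-! A strongly normalizing term already has a type in the assignment system `Has`, which uses
neither subtyping nor `ω`. Such a derivation turns into a `Δ`-term in which both components of every
pair have literally the same essence, so the choice of type theory and of relation plays no role
(`Has.exists_typed`). Typability is proved by induction along β-steps and passage to subterms
together, which is well-founded below a strongly normalizing term. An abstraction is typed from its
body. A variable applied to typable arguments takes any type, by declaring a suitable arrow type for
its head. Otherwise there is a weak head redex: its contractum and its argument are typable by
induction, and subject expansion (`WeakHead.expand`, resting on `Has.of_subst`) types the term
itself. The argument has to be typable separately because contraction may erase it. Different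
contexts are merged by pointwise intersection. -/

variable {𝔸 : Set Atom}

/-! ### Curry-style intersection type assignment -/

/-- Infinite contexts: every variable is declared. -/
abbrev Ctx (𝔸 : Set Atom) : Type := ℕ → Ty 𝔸

/-- Extension of a context by a type for the variable `0`. -/
def Ctx.cons (τ : Ty 𝔸) (Γ : Ctx 𝔸) : Ctx 𝔸
  | 0 => τ
  | n + 1 => Γ n

/-- Pointwise intersection of contexts. -/
def Ctx.inter (Γ Δ : Ctx 𝔸) : Ctx 𝔸 := fun n => Ty.inter (Γ n) (Δ n)

/-- Intersection type assignment for pure terms, without subtyping. -/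
inductive Has : Ctx 𝔸 → Term → Ty 𝔸 → Prop where
  | var (Γ : Ctx 𝔸) (n : ℕ) : Has Γ (Term.var n) (Γ n)
  | lam {Γ : Ctx 𝔸} {M : Term} {σ τ : Ty 𝔸} :
      Has (Γ.cons σ) M τ → Has Γ (Term.lam M) (Ty.arrow σ τ)
  | app {Γ : Ctx 𝔸} {M N : Term} {σ τ : Ty 𝔸} :
      Has Γ M (Ty.arrow σ τ) → Has Γ N σ → Has Γ (Term.app M N) τ
  | inter {Γ : Ctx 𝔸} {M : Term} {σ τ : Ty 𝔸} : Has Γ M σ → Has Γ M τ → Has Γ M (Ty.inter σ τ)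
  | fst {Γ : Ctx 𝔸} {M : Term} {σ τ : Ty 𝔸} : Has Γ M (Ty.inter σ τ) → Has Γ M σ
  | snd {Γ : Ctx 𝔸} {M : Term} {σ τ : Ty 𝔸} : Has Γ M (Ty.inter σ τ) → Has Γ M τ

/-- An assignment derivation is decorated by a `Δ`-term, in every list that is long enough and
agrees with the context. -/
theorem Has.exists_typed (T : TypeTheory 𝔸) (R : EssRel) {Γ : Ctx 𝔸} {M : Term} {σ : Ty 𝔸}
    (h : Has Γ M σ) :
    ∃ k : ℕ, ∀ B : Basis 𝔸, (∀ i < k, B[i]? = some (Γ i)) →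
      ∃ D : DTerm 𝔸, Typed T R B D σ ∧ D.essence = M := by
  induction h with
  | var Γ n => exact ⟨n + 1, fun B hB => ⟨.var n, .ax (hB n n.lt_succ_self), rfl⟩⟩
  | @lam Γ M σ τ _ ih =>
    obtain ⟨k, hk⟩ := ih
    refine ⟨k, fun B hB => ?_⟩
    obtain ⟨D, hD, he⟩ := hk (σ :: B) (by
      intro i hi
      cases i with
      | zero => rfl
      | succ i => simpa [Ctx.cons] using hB i (by omega))
    exact ⟨.lam σ D, .arrowI hD, by simp [DTerm.essence, he]⟩
  | app _ _ ih₁ ih₂ =>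
    obtain ⟨k₁, h₁⟩ := ih₁
    obtain ⟨k₂, h₂⟩ := ih₂
    refine ⟨max k₁ k₂, fun B hB => ?_⟩
    obtain ⟨D₁, hD₁, he₁⟩ := h₁ B fun i hi => hB i (by omega)
    obtain ⟨D₂, hD₂, he₂⟩ := h₂ B fun i hi => hB i (by omega)
    exact ⟨.app D₁ D₂, .arrowE hD₁ hD₂, by simp [DTerm.essence, he₁, he₂]⟩
  | inter _ _ ih₁ ih₂ =>
    obtain ⟨k₁, h₁⟩ := ih₁
    obtain ⟨k₂, h₂⟩ := ih₂
    refine ⟨max k₁ k₂, fun B hB => ?_⟩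
    obtain ⟨D₁, hD₁, he₁⟩ := h₁ B fun i hi => hB i (by omega)
    obtain ⟨D₂, hD₂, he₂⟩ := h₂ B fun i hi => hB i (by omega)
    refine ⟨.pair D₁ D₂, .interI hD₁ hD₂ ?_, he₁⟩
    -- Both essences are `M`, so reflexivity of the relation suffices.
    rw [he₁, he₂]
    cases R
    · rfl
    · exact .refl _
    · exact .refl _
  | fst _ ih =>
    obtain ⟨k, hk⟩ := ih
    refine ⟨k, fun B hB => ?_⟩
    obtain ⟨D, hD, he⟩ := hk B hB
    exact ⟨.pr1 D, .interE1 hD, he⟩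
  | snd _ ih =>
    obtain ⟨k, hk⟩ := ih
    refine ⟨k, fun B hB => ?_⟩
    obtain ⟨D, hD, he⟩ := hk B hB
    exact ⟨.pr2 D, .interE2 hD, he⟩

theorem Has.exists_typable (T : TypeTheory 𝔸) (R : EssRel) {Γ : Ctx 𝔸} {M : Term} {σ : Ty 𝔸}
    (h : Has Γ M σ) : ∃ D : DTerm 𝔸, Typable T R D ∧ D.essence = M := by
  obtain ⟨k, hk⟩ := h.exists_typed T R
  obtain ⟨D, hD, he⟩ := hk ((List.range k).map Γ) (by intro i hi; simp [hi])
  exact ⟨D, ⟨_, _, hD⟩, he⟩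

/-! ### Renaming, weakening and inversion of substitution -/

theorem Ctx.cons_liftRen (τ : Ty 𝔸) (Γ : Ctx 𝔸) (f : ℕ → ℕ) :
    (fun n => Γ.cons τ (Term.liftRen f n)) = Ctx.cons τ fun n => Γ (f n) := by
  funext n
  cases n <;> rfl

theorem Has.rename {Γ : Ctx 𝔸} {M : Term} {σ : Ty 𝔸} (h : Has Γ M σ) :
    ∀ {f : ℕ → ℕ} {Δ : Ctx 𝔸}, (fun n => Δ (f n)) = Γ → Has Δ (M.rename f) σ := by
  induction h with
  | var Γ n => rintro f Δ rfl; exact .var Δ (f n)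
  | lam _ ih => rintro f Δ rfl; exact .lam (ih (Ctx.cons_liftRen _ _ _))
  | app _ _ ih₁ ih₂ => intro f Δ hf; exact .app (ih₁ hf) (ih₂ hf)
  | inter _ _ ih₁ ih₂ => intro f Δ hf; exact .inter (ih₁ hf) (ih₂ hf)
  | fst _ ih => intro f Δ hf; exact .fst (ih hf)
  | snd _ ih => intro f Δ hf; exact .snd (ih hf)

/-- With `f = Nat.succ` this is strengthening: a variable outside the range of `f` cannot matter.
Pulling the context back along `f` makes injectivity unnecessary. -/
theorem Has.of_rename {Δ : Ctx 𝔸} {N : Term} {σ : Ty 𝔸} (h : Has Δ N σ) :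
    ∀ {f : ℕ → ℕ} {M : Term}, M.rename f = N → Has (fun n => Δ (f n)) M σ := by
  induction h with
  | var Γ n =>
    intro f M hM
    cases M <;> simp only [Term.rename, Term.var.injEq, reduceCtorEq] at hM
    subst hM
    exact .var (fun n => Γ (f n)) _
  | lam _ ih =>
    intro f M hM
    cases M <;> simp only [Term.rename, Term.lam.injEq, reduceCtorEq] at hM
    refine .lam ?_
    rw [← Ctx.cons_liftRen]
    exact ih hM
  | app _ _ ih₁ ih₂ =>
    intro f M hM
    cases M <;> simp only [Term.rename, Term.app.injEq, reduceCtorEq] at hM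
    exact .app (ih₁ hM.1) (ih₂ hM.2)
  | inter _ _ ih₁ ih₂ => intro f M hM; exact .inter (ih₁ hM) (ih₂ hM)
  | fst _ ih => intro f M hM; exact .fst (ih hM)
  | snd _ ih => intro f M hM; exact .snd (ih hM)

theorem Has.shift {Γ : Ctx 𝔸} {M : Term} {σ : Ty 𝔸} (τ : Ty 𝔸) (h : Has Γ M σ) :
    Has (Γ.cons τ) M.shift σ :=
  h.rename rfl

theorem Has.of_shift {Γ : Ctx 𝔸} {M : Term} {σ τ : Ty 𝔸} (h : Has (Γ.cons τ) M.shift σ) :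
    Has Γ M σ :=
  h.of_rename rfl

theorem Has.var_congr {Γ Δ : Ctx 𝔸} {n m : ℕ} {σ : Ty 𝔸} (h : Has Γ (.var n) σ)
    (hnm : Γ n = Δ m) : Has Δ (.var m) σ := by
  generalize hM : Term.var n = M at h
  induction h with
  | var Γ k => cases hM; rw [hnm]; exact .var Δ m
  | lam => cases hM
  | app => cases hM
  | inter _ _ ih₁ ih₂ => exact .inter (ih₁ hnm hM) (ih₂ hnm hM)
  | fst _ ih => exact .fst (ih hnm hM)
  | snd _ ih => exact .snd (ih hnm hM)

/-- Plays the role of subtyping between contexts: each use of a declared type is replaced by a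
derivation of it, for instance a projection from an intersection. -/
theorem Has.weaken {Γ : Ctx 𝔸} {M : Term} {σ : Ty 𝔸} (h : Has Γ M σ) :
    ∀ {Δ : Ctx 𝔸}, (∀ n, Has Δ (.var n) (Γ n)) → Has Δ M σ := by
  induction h with
  | var Γ n => intro Δ hΔ; exact hΔ n
  | lam _ ih =>
    intro Δ hΔ
    refine .lam (ih fun n => ?_)
    cases n with
    | zero => exact .var (Δ.cons _) 0
    | succ n => exact (hΔ n).shift _
  | app _ _ ih₁ ih₂ => intro Δ hΔ; exact .app (ih₁ hΔ) (ih₂ hΔ)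
  | inter _ _ ih₁ ih₂ => intro Δ hΔ; exact .inter (ih₁ hΔ) (ih₂ hΔ)
  | fst _ ih => intro Δ hΔ; exact .fst (ih hΔ)
  | snd _ ih => intro Δ hΔ; exact .snd (ih hΔ)

theorem Has.inter_left {Γ : Ctx 𝔸} {M : Term} {σ : Ty 𝔸} (h : Has Γ M σ) (Δ : Ctx 𝔸) :
    Has (Γ.inter Δ) M σ :=
  h.weaken fun n => .fst (.var (Γ.inter Δ) n)

theorem Has.inter_right {Δ : Ctx 𝔸} {M : Term} {σ : Ty 𝔸} (h : Has Δ M σ) (Γ : Ctx 𝔸) :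
    Has (Γ.inter Δ) M σ :=
  h.weaken fun n => .snd (.var (Γ.inter Δ) n)

/-- A typed instance of `M` by typable terms comes from a typing of `M`. -/
theorem Has.of_subst {Γ : Ctx 𝔸} {P : Term} {σ : Ty 𝔸} (h : Has Γ P σ) :
    ∀ {s : ℕ → Term} {M : Term}, M.subst s = P → (∀ n, ∃ ρ, Has Γ (s n) ρ) →
      ∃ Θ : Ctx 𝔸, Has Θ M σ ∧ ∀ n, Has Γ (s n) (Θ n) := by
  have var_case : ∀ {Γ : Ctx 𝔸} {s : ℕ → Term} {n : ℕ} {σ : Ty 𝔸}, Has Γ (s n) σ →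
      (∀ n, ∃ ρ, Has Γ (s n) ρ) → ∃ Θ : Ctx 𝔸, Has Θ (.var n) σ ∧ ∀ n, Has Γ (s n) (Θ n) := by
    intro Γ s n σ hn hs
    -- `Θ` must declare every variable, so those other than `n` receive the types that `hs`
    -- supplies; this is why all `s n` are assumed typable.
    choose Θ hΘ using hs
    refine ⟨Function.update Θ n σ, ?_, fun m => ?_⟩
    · simpa using Has.var (Function.update Θ n σ) n
    · by_cases hm : m = n
      · subst hm; simpa using hn
      · simpa [hm] using hΘ m
  induction h with
  | var Γ n =>
    intro s M hM hs
    cases M <;> simp only [Term.subst, reduceCtorEq] at hM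
    exact var_case (hM ▸ .var Γ n) hs
  | @lam Γ P σ τ hP ih =>
    intro s M hM hs
    cases M <;> simp only [Term.subst, Term.lam.injEq, reduceCtorEq] at hM
    · exact var_case (hM ▸ .lam hP) hs
    · obtain ⟨Θ, hΘ, hsΘ⟩ := ih hM (by
        intro n
        cases n with
        | zero => exact ⟨_, .var (Γ.cons σ) 0⟩
        | succ n => obtain ⟨ρ, hρ⟩ := hs n; exact ⟨ρ, hρ.shift σ⟩)
      -- The bound variable was declared with `σ`, not `Θ 0`; but it derives `Θ 0` from `σ`, so the
      -- body can be retyped with `σ` in that place.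
      refine ⟨fun n => Θ (n + 1), .lam (hΘ.weaken fun n => ?_), fun n => (hsΘ (n + 1)).of_shift⟩
      cases n with
      | zero => exact (hsΘ 0).var_congr rfl
      | succ n => exact .var (Ctx.cons σ fun n => Θ (n + 1)) (n + 1)
  | app h₁ h₂ ih₁ ih₂ =>
    intro s M hM hs
    cases M <;> simp only [Term.subst, Term.app.injEq, reduceCtorEq] at hM
    · exact var_case (hM ▸ .app h₁ h₂) hs
    · obtain ⟨Θ₁, hΘ₁, hs₁⟩ := ih₁ hM.1 hs
      obtain ⟨Θ₂, hΘ₂, hs₂⟩ := ih₂ hM.2 hs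
      exact ⟨Θ₁.inter Θ₂, .app (hΘ₁.inter_left _) (hΘ₂.inter_right _),
        fun n => .inter (hs₁ n) (hs₂ n)⟩
  | inter _ _ ih₁ ih₂ =>
    intro s M hM hs
    obtain ⟨Θ₁, hΘ₁, hs₁⟩ := ih₁ hM hs
    obtain ⟨Θ₂, hΘ₂, hs₂⟩ := ih₂ hM hs
    exact ⟨Θ₁.inter Θ₂, .inter (hΘ₁.inter_left _) (hΘ₂.inter_right _),
      fun n => .inter (hs₁ n) (hs₂ n)⟩
  | fst _ ih =>
    intro s M hM hs
    obtain ⟨Θ, hΘ, hsΘ⟩ := ih hM hs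
    exact ⟨Θ, .fst hΘ, hsΘ⟩
  | snd _ ih =>
    intro s M hM hs
    obtain ⟨Θ, hΘ, hsΘ⟩ := ih hM hs
    exact ⟨Θ, .snd hΘ, hsΘ⟩

/-- Subject expansion for a redex whose argument is typable. -/
theorem Has.redex_of_inst {Γ : Ctx 𝔸} {M N : Term} {σ ρ : Ty 𝔸} (h : Has Γ (M.inst N) σ)
    (hN : Has Γ N ρ) : Has Γ (.app (.lam M) N) σ := by
  obtain ⟨Θ, hΘ, hs⟩ := h.of_subst rfl (by
    intro n
    cases n with
    | zero => exact ⟨ρ, hN⟩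
    | succ n => exact ⟨_, .var Γ n⟩)
  -- `Θ 0` gathers the types at which the copies of `N` are used, and becomes the domain of the
  -- abstraction.
  refine .app (.lam (hΘ.weaken fun n => ?_)) (hs 0)
  cases n with
  | zero => exact .var (Γ.cons (Θ 0)) 0
  | succ n => exact (hs (n + 1)).shift (Θ 0)

/-! ### Weak head reduction and neutral terms -/

/-- `WeakHead N M M'`: `M` reduces to `M'` by contracting its weak head redex, whose argument
is `N`. -/
inductive WeakHead (N : Term) : Term → Term → Prop where
  | redex (M : Term) : WeakHead N (.app (.lam M) N) (M.inst N)
  | appL {M M' : Term} (P : Term) : WeakHead N M M' → WeakHead N (.app M P) (.app M' P)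

/-- A variable applied to a list of arguments. -/
inductive Neutral : Term → Prop where
  | var (n : ℕ) : Neutral (.var n)
  | app {M : Term} (N : Term) : Neutral M → Neutral (.app M N)

theorem WeakHead.beta {N M M' : Term} (h : WeakHead N M M') : Term.Beta M M' := by
  induction h with
  | redex M => exact .redex M N
  | appL P _ ih => exact .appL P ih

theorem Term.lam_or_neutral_or_weakHead (M : Term) :
    (∃ P, M = .lam P) ∨ Neutral M ∨ ∃ N M', WeakHead N M M' := by
  induction M with
  | var n => exact .inr (.inl (.var n))
  | lam P => exact .inl ⟨P, rfl⟩
  | app M N ihM _ =>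
    rcases ihM with ⟨P, rfl⟩ | h | ⟨Q, M', h⟩
    · exact .inr (.inr ⟨N, _, .redex P⟩)
    · exact .inr (.inl (.app N h))
    · exact .inr (.inr ⟨Q, _, .appL N h⟩)

/-- The last rule may be an intersection rule rather than an application, hence an induction on the
derivation; `ih` covers all types because the arrow types inside it are unknown. -/
theorem Has.app_of_forall {Γ : Ctx 𝔸} {M M' P : Term} {σ : Ty 𝔸}
    (ih : ∀ τ, Has Γ M' τ → Has Γ M τ) (h : Has Γ (.app M' P) σ) : Has Γ (.app M P) σ := by
  generalize hQ : Term.app M' P = Q at h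
  induction h with
  | var => cases hQ
  | lam => cases hQ
  | app h₁ h₂ => cases hQ; exact .app (ih _ h₁) h₂
  | inter _ _ ih₁ ih₂ => exact .inter (ih₁ ih hQ) (ih₂ ih hQ)
  | fst _ ih₁ => exact .fst (ih₁ ih hQ)
  | snd _ ih₁ => exact .snd (ih₁ ih hQ)

theorem WeakHead.expand {Γ : Ctx 𝔸} {N M M' : Term} {ρ : Ty 𝔸} (h : WeakHead N M M')
    (hN : Has Γ N ρ) : ∀ σ, Has Γ M' σ → Has Γ M σ := by
  induction h with
  | redex M => exact fun σ hM => hM.redex_of_inst hN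
  | appL P _ ih => exact fun σ hM => hM.app_of_forall ih

/-! ### Strongly normalizing terms are typable -/

/-- One `β`-step, or passage to an immediate subterm; the smaller term comes first. -/
inductive Term.Smaller : Term → Term → Prop where
  | beta {M M' : Term} : Term.Beta M M' → Smaller M' M
  | lam (M : Term) : Smaller M (.lam M)
  | appL (M N : Term) : Smaller M (.app M N)
  | appR (M N : Term) : Smaller N (.app M N)

/-- A step in a subterm is a step of the whole term, whose reduct is accessible and contains the
reduced subterm; structural induction then makes the immediate subterms accessible. -/
theorem Term.acc_smaller_of_reducts (M : Term) :
    (∀ M', Term.Beta M M' → Acc Term.Smaller M') → Acc Term.Smaller M := by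
  induction M with
  | var n =>
    intro h
    refine .intro _ fun N hN => ?_
    cases hN with
    | beta hb => exact h _ hb
  | lam P ih =>
    intro h
    refine .intro _ fun N hN => ?_
    cases hN with
    | beta hb => exact h _ hb
    | lam => exact ih fun P' hP => (h _ (.lam hP)).inv (.lam P')
  | app P Q ihP ihQ =>
    intro h
    refine .intro _ fun N hN => ?_
    cases hN with
    | beta hb => exact h _ hb
    | appL => exact ihP fun P' hP => (h _ (.appL Q hP)).inv (.appL P' Q)
    | appR => exact ihQ fun Q' hQ => (h _ (.appR P hQ)).inv (.appR P Q')

theorem Term.StronglyNormalizing.acc {M : Term} (h : M.StronglyNormalizing) :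
    Acc (fun N M => Term.Beta M N) M := by
  by_contra hM
  have step : ∀ P : {P : Term // ¬ Acc (fun N M => Term.Beta M N) P},
      ∃ Q : {P : Term // ¬ Acc (fun N M => Term.Beta M N) P}, Term.Beta P.1 Q.1 := by
    rintro ⟨P, hP⟩
    by_contra hQ
    push Not at hQ
    exact hP (.intro _ fun Q hPQ => by_contra fun hn => hQ ⟨Q, hn⟩ hPQ)
  choose f hf using step
  refine h ⟨fun n => (f^[n] ⟨M, hM⟩).1, rfl, fun n => ?_⟩
  simp only [Function.iterate_succ_apply']
  exact hf _

theorem Term.StronglyNormalizing.acc_smaller {M : Term} (h : M.StronglyNormalizing) :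
    Acc Term.Smaller M := by
  induction h.acc with
  | intro M _ ih =>
    exact M.acc_smaller_of_reducts fun M' hM' => ih M' hM' fun ⟨s, h0, hs⟩ =>
      -- An infinite reduction from the reduct, preceded by `M`, would be one from `M`.
      h ⟨fun n => Nat.casesOn n M s, rfl, fun n => by
        cases n with
        | zero => subst h0; exact hM'
        | succ n => exact hs n⟩

/-- The second claim needs every `σ`, since the function part of a neutral application must receive
the type `ρ → σ`. The third descends the spine to the head redex, whose argument need not be an
immediate subterm. -/
theorem Term.exists_has_of_acc (α : 𝔸) {M : Term} (h : Acc Term.Smaller M) :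
    (∃ (Γ : Ctx 𝔸) (σ : Ty 𝔸), Has Γ M σ) ∧
    (Neutral M → ∀ σ : Ty 𝔸, ∃ Γ : Ctx 𝔸, Has Γ M σ) ∧
    (∀ N M', WeakHead N M M' → ∃ (Γ : Ctx 𝔸) (ρ : Ty 𝔸), Has Γ N ρ) := by
  induction h with
  | intro M _ ih =>
    have neutral : Neutral M → ∀ σ : Ty 𝔸, ∃ Γ : Ctx 𝔸, Has Γ M σ := by
      rintro (n | ⟨N, hM⟩) σ
      · exact ⟨fun _ => σ, .var _ n⟩
      · obtain ⟨Γ, ρ, hN⟩ := (ih _ (.appR _ N)).1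
        obtain ⟨Δ, hM⟩ := (ih _ (.appL _ N)).2.1 hM (.arrow ρ σ)
        exact ⟨Δ.inter Γ, .app (hM.inter_left Γ) (hN.inter_right Δ)⟩
    have arg : ∀ N M', WeakHead N M M' → ∃ (Γ : Ctx 𝔸) (ρ : Ty 𝔸), Has Γ N ρ := by
      rintro N _ (P | ⟨P, hM⟩)
      · exact (ih _ (.appR _ N)).1
      · exact (ih _ (.appL _ P)).2.2 _ _ hM
    refine ⟨?_, neutral, arg⟩
    rcases M.lam_or_neutral_or_weakHead with ⟨P, rfl⟩ | hM | ⟨N, M', hM⟩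
    · obtain ⟨Γ, σ, hP⟩ := (ih _ (.lam P)).1
      refine ⟨fun n => Γ (n + 1), .arrow (Γ 0) σ, .lam (hP.weaken fun n => ?_)⟩
      cases n with
      | zero => exact .var (Ctx.cons (Γ 0) fun n => Γ (n + 1)) 0
      | succ n => exact .var (Ctx.cons (Γ 0) fun n => Γ (n + 1)) (n + 1)
    · obtain ⟨Γ, h⟩ := neutral hM (.atom α)
      exact ⟨Γ, _, h⟩
    · obtain ⟨Γ, ρ, hN⟩ := arg N M' hM
      obtain ⟨Δ, σ, hM'⟩ := (ih _ (.beta hM.beta)).1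
      exact ⟨Δ.inter Γ, σ, hM.expand (hN.inter_right Δ) σ (hM'.inter_left Γ)⟩

/-- Strongly normalizing terms are essences of typable `Δ`-terms. -/
theorem Term.StronglyNormalizing.exists_typable (h𝔸 : 𝔸.Nonempty) (T : TypeTheory 𝔸)
    (R : EssRel) {M : Term} (h : M.StronglyNormalizing) :
    ∃ D : DTerm 𝔸, Typable T R D ∧ D.essence = M := by
  obtain ⟨a, ha⟩ := h𝔸
  obtain ⟨Γ, σ, hM⟩ := (Term.exists_has_of_acc ⟨a, ha⟩ h.acc_smaller).1
  exact hM.exists_typable T R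

theorem Chair.nonempty {T : TypeTheory 𝔸} {R : EssRel} (h : Chair 𝔸 T R) : 𝔸.Nonempty := by
  have h₁ : atomsInf.Nonempty := ⟨_, 0, rfl⟩
  have h₂ : atomsInfOmega.Nonempty := h₁.inl
  cases h <;> assumption

end DeltaCalculus

/-- In each of the ten systems of the `Δ`-chair, and more generally in the system given by any
intersection type theory over a nonempty set of atoms and any of the three relations on essences,
every strongly normalizing pure `λ`-term is the essence of a typable `Δ`-term. -/
theorem mainTheorem7 :
    (∀ (𝔸 : Set DeltaCalculus.Atom) (T : DeltaCalculus.TypeTheory 𝔸) (R : DeltaCalculus.EssRel),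
      DeltaCalculus.Chair 𝔸 T R →
      ∀ M : DeltaCalculus.Term, M.StronglyNormalizing →
        ∃ D : DeltaCalculus.DTerm 𝔸, DeltaCalculus.Typable T R D ∧ D.essence = M) ∧
    (∀ (𝔸 : Set DeltaCalculus.Atom), 𝔸.Nonempty →
      ∀ (T : DeltaCalculus.TypeTheory 𝔸) (R : DeltaCalculus.EssRel),
      ∀ M : DeltaCalculus.Term, M.StronglyNormalizing →
        ∃ D : DeltaCalculus.DTerm 𝔸, DeltaCalculus.Typable T R D ∧ D.essence = M) := by
  exact ⟨fun _ T R hC _ hM => hM.exists_typable hC.nonempty T R,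
    fun _ h𝔸 T R _ hM => hM.exists_typable h𝔸 T R⟩
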